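/- Let $L, M$ be full-rank lattices in $\mathbb{R}^d$ (discrete subgroups of $\mathbb{R}^d$ that span $\mathbb{R}^d$ over $\mathbb{R}$) with $\mathrm{vol}(L) < \mathrm{vol}(M)$, where $\mathrm{vol}$ denotes the Lebesgue measure of a fundamental parallelepiped of the lattice. Then there is a bounded measurable set $F \subseteq \mathbb{R}^d$, which can be taken to be a finite union of polytopes (a polytope being the convex hull of a finite set of points), such that $F$ tiles $\mathbb{R}^d$ by translations with $L$ and packs $\mathbb{R}^d$ by translations with $M$; that is, $$\sum_{t \in L} \mathbf{1}_F(x+t) = 1 \quad\text{and}\quad \sum_{t \in M} \mathbf{1}_F(x+t) \le 1 \qquad \text{for almost every } x \in \mathbb{R}^d.$$ -/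

import Mathlib

open scoped ENNReal
open MeasureTheory

/-- `Ω` packs the space by translations by `A`: `∑_{t ∈ A} 1_Ω(x + t) ≤ 1` for almost every `x`.
The sum is taken in `[0, ∞]`, where it always exists. -/
def PacksBy {E : Type*} [AddCommGroup E] [MeasureSpace E] (Ω A : Set E) : Prop :=
  ∀ᵐ x : E, ∑' t : A, Ω.indicator (fun _ => (1 : ℝ≥0∞)) (x + (t : E)) ≤ 1

/-- `Ω` tiles the space by translations by `A`: `∑_{t ∈ A} 1_Ω(x + t) = 1` for almost every `x`. -/
def TilesBy {E : Type*} [AddCommGroup E] [MeasureSpace E] (Ω A : Set E) : Prop :=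
  ∀ᵐ x : E, ∑' t : A, Ω.indicator (fun _ => (1 : ℝ≥0∞)) (x + (t : E)) = 1

/-- A polytope is the convex hull of a finite set of points. -/
def IsPolytope {E : Type*} [AddCommGroup E] [Module ℝ E] (P : Set E) : Prop :=
  ∃ V : Set E, V.Finite ∧ P = convexHull ℝ V

/-- `F` is the union of finitely many polytopes. -/
def IsFiniteUnionOfPolytopes {E : Type*} [AddCommGroup E] [Module ℝ E] (F : Set E) : Prop :=
  ∃ S : Set (Set E), S.Finite ∧ (∀ P ∈ S, IsPolytope P) ∧ F = ⋃₀ S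

/-
The closure `H` of `L + M` is `ℝ^α × ℤ^β` in the coordinates of a suitable basis. Rounding down the
coordinates in `β` maps the space onto `H` and commutes with translations by `H`, so the preimages
`A` and `B` under this map of fundamental parallelepipeds of `L` and `M` are again fundamental
domains, with `vol A < vol B`. Cut the directions of `α` into cells of side `1 / (n + 2)`, and also
into the slightly larger cells of side `1 / (n + 1)`. Neither kind of cell is cut by `A` or `B`
in the directions of `β`, so for large `n` at most as many small cells meet `A` as there are large
cells inside `B`. Match them injectively. A small cell has room to move inside a large one and
`L + M` is dense in `H`, so some `l + m` with `l ∈ L`, `m ∈ M` moves the small cell into the large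
one matched with it. Moving the piece of `A` in each small cell by `l` alone gives a set that is
congruent to `A` modulo `L` and to a subset of `B` modulo `M`.
-/

open Topology

section Polyhedra

variable {E : Type*} [AddCommGroup E] [Module ℝ E]

/-- The closed polyhedron cut out by a set of linear inequalities `f x ≤ a`, each of them encoded
as the pair `(f, a)`. -/
def polyhedron (C : Set (Module.Dual ℝ E × ℝ)) : Set E := {x | ∀ c ∈ C, c.1 x ≤ c.2}

/-- The set cut out by strict linear inequalities `f x < a`, each of them encoded as the pair
`(f, a)`. -/
def strictPolyhedron (C : Set (Module.Dual ℝ E × ℝ)) : Set E := {x | ∀ c ∈ C, c.1 x < c.2}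

/-- A half-open polyhedron is a set cut out by finitely many weak and finitely many strict linear
inequalities. The pieces of all the dissections below are of this kind, so that they can be
disjoint. -/
def IsHalfOpenPolyhedron (p : Set E) : Prop :=
  ∃ C S : Set (Module.Dual ℝ E × ℝ), C.Finite ∧ S.Finite ∧ p = polyhedron C ∩ strictPolyhedron S

/-- A polyhedral set is a finite union of half-open polyhedra. -/
def IsPolyhedral (F : Set E) : Prop :=
  ∃ S : Set (Set E), S.Finite ∧ (∀ p ∈ S, IsHalfOpenPolyhedron p) ∧ F = ⋃₀ S

theorem polyhedron_union (C S : Set (Module.Dual ℝ E × ℝ)) :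
    polyhedron (C ∪ S) = polyhedron C ∩ polyhedron S := by
  ext x
  simp only [polyhedron, Set.mem_union, or_imp, forall_and, Set.mem_ofPred_eq, Set.mem_inter_iff]

theorem strictPolyhedron_union (C S : Set (Module.Dual ℝ E × ℝ)) :
    strictPolyhedron (C ∪ S) = strictPolyhedron C ∩ strictPolyhedron S := by
  ext x
  simp only [strictPolyhedron, Set.mem_union, or_imp, forall_and, Set.mem_ofPred_eq,
    Set.mem_inter_iff]

theorem strictPolyhedron_subset_polyhedron (C : Set (Module.Dual ℝ E × ℝ)) :
    strictPolyhedron C ⊆ polyhedron C :=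
  fun _ hx c hc => (hx c hc).le

theorem convex_polyhedron (C : Set (Module.Dual ℝ E × ℝ)) : Convex ℝ (polyhedron C) := by
  simp only [polyhedron, Set.ofPred_forall]
  exact convex_iInter₂ fun c _ => convex_halfSpace_le c.1.isLinear c.2

theorem convex_strictPolyhedron (C : Set (Module.Dual ℝ E × ℝ)) :
    Convex ℝ (strictPolyhedron C) := by
  simp only [strictPolyhedron, Set.ofPred_forall]
  exact convex_iInter₂ fun c _ => convex_halfSpace_lt c.1.isLinear c.2

theorem eventually_add_smul_mem_polyhedron {C : Set (Module.Dual ℝ E × ℝ)} (hC : C.Finite)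
    {x v : E} (hx : x ∈ polyhedron C) (hv : ∀ c ∈ C, c.1 x = c.2 → c.1 v = 0) :
    ∀ᶠ t : ℝ in 𝓝 0, x + t • v ∈ polyhedron C := by
  refine (Filter.eventually_all_finite hC).2 fun c hc => ?_
  simp only [map_add, map_smul, smul_eq_mul]
  rcases (hx c hc).eq_or_lt with hactive | hinactive
  · simp [hv c hc hactive, hactive]
  · have hcont : Continuous fun t : ℝ => c.1 x + t * c.1 v := by fun_prop
    exact (hcont.tendsto' 0 (c.1 x) (by simp)).eventually_le_const hinactive

theorem eq_of_mem_extremePoints_polyhedron {C : Set (Module.Dual ℝ E × ℝ)} (hC : C.Finite)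
    {x y : E} (hx : x ∈ (polyhedron C).extremePoints ℝ)
    (hxy : ∀ c ∈ C, c.1 x = c.2 → c.1 y = c.2) : x = y := by
  have hactive : ∀ c ∈ C, c.1 x = c.2 → c.1 (y - x) = 0 := fun c hc h => by
    rw [map_sub, hxy c hc h, h, sub_self]
  have hadd := eventually_add_smul_mem_polyhedron hC hx.1 hactive
  have hsub : ∀ᶠ t : ℝ in 𝓝 0, x + (-t) • (y - x) ∈ polyhedron C :=
    (continuous_neg.tendsto' 0 0 neg_zero).eventually hadd
  obtain ⟨t, ⟨ht_add, ht_sub⟩, ht : 0 < t⟩ :=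
    (((hadd.and hsub).filter_mono nhdsWithin_le_nhds).and
      (self_mem_nhdsWithin (s := Set.Ioi (0 : ℝ)))).exists
  have hseg : x ∈ openSegment ℝ (x + t • (y - x)) (x + (-t) • (y - x)) :=
    ⟨1 / 2, 1 / 2, by norm_num, by norm_num, by norm_num, by module⟩
  have hzero : t • (y - x) = 0 := by simpa using hx.2 ht_add ht_sub hseg
  exact (sub_eq_zero.1 ((smul_eq_zero_iff_right ht.ne').1 hzero)).symm

theorem finite_extremePoints_polyhedron {C : Set (Module.Dual ℝ E × ℝ)} (hC : C.Finite) :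
    ((polyhedron C).extremePoints ℝ).Finite := by
  let activeAt (x : E) : Set (Module.Dual ℝ E × ℝ) := {c ∈ C | c.1 x = c.2}
  refine Set.Finite.of_finite_image (f := activeAt) (hC.finite_subsets.subset ?_) ?_
  · rintro _ ⟨x, -, rfl⟩
    exact Set.sep_subset _ _
  · intro x hx y _ hxy
    exact eq_of_mem_extremePoints_polyhedron hC hx fun c hc h =>
      ((Set.ext_iff.1 hxy c).1 ⟨hc, h⟩).2

namespace IsHalfOpenPolyhedron

theorem convex {p : Set E} (hp : IsHalfOpenPolyhedron p) : Convex ℝ p := by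
  obtain ⟨C, S, -, -, rfl⟩ := hp
  exact (convex_polyhedron C).inter (convex_strictPolyhedron S)

theorem inter {p q : Set E} (hp : IsHalfOpenPolyhedron p) (hq : IsHalfOpenPolyhedron q) :
    IsHalfOpenPolyhedron (p ∩ q) := by
  obtain ⟨C, S, hC, hS, rfl⟩ := hp
  obtain ⟨C', S', hC', hS', rfl⟩ := hq
  refine ⟨C ∪ C', S ∪ S', hC.union hC', hS.union hS', ?_⟩
  rw [polyhedron_union, strictPolyhedron_union, Set.inter_inter_inter_comm]

theorem preimage_linear_add {E' : Type*} [AddCommGroup E'] [Module ℝ E'] {p : Set E}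
    (hp : IsHalfOpenPolyhedron p) (f : E' →ₗ[ℝ] E) (v : E) :
    IsHalfOpenPolyhedron ((fun x => f x + v) ⁻¹' p) := by
  obtain ⟨C, S, hC, hS, rfl⟩ := hp
  let pull (c : Module.Dual ℝ E × ℝ) : Module.Dual ℝ E' × ℝ := (c.1 ∘ₗ f, c.2 - c.1 v)
  refine ⟨pull '' C, pull '' S, hC.image _, hS.image _, ?_⟩
  ext x
  simp only [polyhedron, strictPolyhedron, pull, Set.preimage_inter, Set.mem_inter_iff,
    Set.mem_preimage, Set.mem_ofPred_eq, Set.forall_mem_image, map_add, LinearMap.comp_apply,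
    le_sub_iff_add_le, lt_sub_iff_add_lt]

theorem preimage_add_right {p : Set E} (hp : IsHalfOpenPolyhedron p) (v : E) :
    IsHalfOpenPolyhedron ((fun x => x + v) ⁻¹' p) :=
  hp.preimage_linear_add LinearMap.id v

end IsHalfOpenPolyhedron

theorem isPolyhedral_biUnion {κ : Type*} {s : Set κ} (hs : s.Finite) {p : κ → Set E}
    (hp : ∀ i ∈ s, IsHalfOpenPolyhedron (p i)) : IsPolyhedral (⋃ i ∈ s, p i) :=
  ⟨p '' s, hs.image p, Set.forall_mem_image.2 hp, (Set.sUnion_image p s).symm⟩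

end Polyhedra

theorem frontier_sUnion_subset {X : Type*} [TopologicalSpace X] {S : Set (Set X)}
    (hS : S.Finite) : frontier (⋃₀ S) ⊆ ⋃ p ∈ S, frontier p := by
  intro x hx
  rw [frontier, hS.closure_sUnion] at hx
  obtain ⟨p, hp, hxp⟩ := Set.mem_iUnion₂.1 hx.1
  exact Set.mem_biUnion hp
    ⟨hxp, fun h => hx.2 (interior_mono (Set.subset_sUnion_of_mem hp) h)⟩

section PolyhedralClosures

variable {E : Type*} [NormedAddCommGroup E] [NormedSpace ℝ E]

theorem isHalfOpenPolyhedron_fundamentalDomain {ι : Type*} [Finite ι] (b : Module.Basis ι ℝ E) :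
    IsHalfOpenPolyhedron (ZSpan.fundamentalDomain b) := by
  refine ⟨Set.range fun i => (-b.coord i, 0), Set.range fun i => (b.coord i, 1),
    Set.finite_range _, Set.finite_range _, ?_⟩
  ext x
  simp [ZSpan.mem_fundamentalDomain, polyhedron, strictPolyhedron, -Prod.forall, forall_and]

variable [FiniteDimensional ℝ E]

theorem isClosed_polyhedron (C : Set (Module.Dual ℝ E × ℝ)) : IsClosed (polyhedron C) := by
  simp only [polyhedron, Set.ofPred_forall]
  exact isClosed_biInter fun c _ =>
    isClosed_le c.1.continuous_of_finiteDimensional continuous_const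

theorem isPolytope_polyhedron {C : Set (Module.Dual ℝ E × ℝ)} (hC : C.Finite)
    (hbd : Bornology.IsBounded (polyhedron C)) : IsPolytope (polyhedron C) := by
  have : ProperSpace E := FiniteDimensional.proper ℝ E
  have hfin := finite_extremePoints_polyhedron hC
  refine ⟨_, hfin, ?_⟩
  rw [← (hfin.isCompact_convexHull ℝ).isClosed.closure_eq, closure_convexHull_extremePoints
    (Metric.isCompact_of_isClosed_isBounded (isClosed_polyhedron C) hbd) (convex_polyhedron C)]

theorem closure_polyhedron_inter_strictPolyhedron {C S : Set (Module.Dual ℝ E × ℝ)}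
    (hne : (polyhedron C ∩ strictPolyhedron S).Nonempty) :
    closure (polyhedron C ∩ strictPolyhedron S) = polyhedron (C ∪ S) := by
  obtain ⟨y, hyC, hyS⟩ := hne
  apply subset_antisymm
  · refine closure_minimal ?_ (isClosed_polyhedron _)
    rw [polyhedron_union]
    exact Set.inter_subset_inter_right _ (strictPolyhedron_subset_polyhedron S)
  · intro x hx
    rw [polyhedron_union] at hx
    have hlim : Filter.Tendsto (fun t : ℝ => x + t • (y - x)) (𝓝[>] 0) (𝓝 x) := by
      have hcont : Continuous fun t : ℝ => x + t • (y - x) := by fun_prop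
      exact (hcont.tendsto' 0 x (by simp)).mono_left nhdsWithin_le_nhds
    refine mem_closure_of_tendsto hlim ?_
    filter_upwards [Ioo_mem_nhdsGT (zero_lt_one (α := ℝ))] with t ⟨ht0, ht1⟩
    refine ⟨(convex_polyhedron C).add_smul_sub_mem hx.1 hyC ⟨ht0.le, ht1.le⟩, fun c hc => ?_⟩
    have hxc : c.1 x ≤ c.2 := hx.2 c hc
    have hyc : c.1 y < c.2 := hyS c hc
    simp only [map_add, map_smul, map_sub, smul_eq_mul]
    nlinarith

theorem IsHalfOpenPolyhedron.isPolytope_closure {p : Set E} (hp : IsHalfOpenPolyhedron p)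
    (hbd : Bornology.IsBounded p) : IsPolytope (closure p) := by
  obtain ⟨C, S, hC, hS, rfl⟩ := hp
  rcases (polyhedron C ∩ strictPolyhedron S).eq_empty_or_nonempty with hempty | hne
  · exact ⟨∅, Set.finite_empty, by simp [hempty]⟩
  · have hclosure := hbd.closure
    rw [closure_polyhedron_inter_strictPolyhedron hne] at hclosure ⊢
    exact isPolytope_polyhedron (hC.union hS) hclosure

theorem IsPolyhedral.isFiniteUnionOfPolytopes_closure {F : Set E} (hF : IsPolyhedral F)
    (hbd : Bornology.IsBounded F) : IsFiniteUnionOfPolytopes (closure F) := by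
  obtain ⟨S, hS, hpoly, rfl⟩ := hF
  refine ⟨closure '' S, hS.image _, Set.forall_mem_image.2 fun p hp => ?_, ?_⟩
  · exact (hpoly p hp).isPolytope_closure (hbd.subset (Set.subset_sUnion_of_mem hp))
  · rw [hS.closure_sUnion, Set.sUnion_image]

theorem IsPolyhedral.addHaar_frontier [MeasurableSpace E] [BorelSpace E] (μ : Measure E)
    [μ.IsAddHaarMeasure] {F : Set E} (hF : IsPolyhedral F) : μ (frontier F) = 0 := by
  obtain ⟨S, hS, hpoly, rfl⟩ := hF
  refine measure_mono_null (frontier_sUnion_subset hS) ?_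
  exact (measure_biUnion_null_iff hS.countable).2 fun p hp => (hpoly p hp).convex.addHaar_frontier μ

end PolyhedralClosures

section Tilings

variable {E : Type*} [AddCommGroup E]

theorem bijOn_mkQ_of_existsUnique_vadd_mem {L : Submodule ℤ E} {F : Set E}
    (hF : ∀ x, ∃! t : L, t +ᵥ x ∈ F) : Set.BijOn L.mkQ F Set.univ := by
  refine ⟨Set.mapsTo_univ _ _, fun x hx y hy hxy => ?_, fun q _ => ?_⟩
  · have hmem : y - x ∈ L := (Submodule.Quotient.eq L).1 hxy.symm
    have hzero : (⟨y - x, hmem⟩ : L) = 0 :=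
      (hF x).unique (by simpa [Submodule.vadd_def] using hy) (by simpa using hx)
    exact (sub_eq_zero.1 (congrArg Subtype.val hzero)).symm
  · obtain ⟨x, rfl⟩ := L.mkQ_surjective q
    obtain ⟨t, ht, -⟩ := hF x
    exact ⟨t +ᵥ x, ht, by simp [Submodule.vadd_def]⟩

theorem tsum_indicator_add_eq_one_of_injOn_mkQ {M : Submodule ℤ E} {G : Set E}
    (hG : Set.InjOn M.mkQ G) {x : E} {t : (M : Set E)} (ht : x + t ∈ G) :
    ∑' s : (M : Set E), G.indicator (fun _ => (1 : ℝ≥0∞)) (x + s) = 1 := by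
  rw [tsum_eq_single t, Set.indicator_of_mem ht]
  refine fun s hst => Set.indicator_of_notMem (fun hs => hst (Subtype.ext ?_)) _
  refine add_left_cancel (hG hs ht ?_)
  simp [(Submodule.Quotient.mk_eq_zero M).2 s.2, (Submodule.Quotient.mk_eq_zero M).2 t.2]

/-- The translations by `l x` do not change the class modulo `L`, and the translations by `m x` do
not change it modulo `M`. -/
theorem bijOn_injOn_mkQ_image_add {L M : Submodule ℤ E} {A B : Set E} {l m : E → E}
    (hA : Set.BijOn L.mkQ A Set.univ) (hB : Set.InjOn M.mkQ B) (hl : ∀ x ∈ A, l x ∈ L)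
    (hm : ∀ x ∈ A, m x ∈ M) (hmaps : Set.MapsTo (fun x => x + l x + m x) A B)
    (hinj : Set.InjOn (fun x => x + l x + m x) A) :
    Set.BijOn L.mkQ ((fun x => x + l x) '' A) Set.univ ∧
      Set.InjOn M.mkQ ((fun x => x + l x) '' A) := by
  have hmodL : Set.EqOn (L.mkQ ∘ fun x => x + l x) L.mkQ A := fun x hx => by
    simpa using hl x hx
  have hmodM : Set.EqOn (M.mkQ ∘ fun x => x + l x) (M.mkQ ∘ fun x => x + l x + m x) A :=
    fun x hx => by simpa using hm x hx
  refine ⟨⟨Set.mapsTo_univ _ _, ?_, ?_⟩, ?_⟩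
  · exact ((hmodL.injOn_iff).2 hA.injOn).image_of_comp
  · rw [Set.SurjOn, ← Set.image_comp, hmodL.image_eq]
    exact hA.surjOn
  · exact ((hmodM.injOn_iff).2 (hB.comp hinj hmaps)).image_of_comp

variable [MeasureSpace E] [MeasurableAdd E] [(volume : Measure E).IsAddLeftInvariant]

theorem ae_tsum_indicator_add_eq {F G : Set E} (hFG : F =ᵐ[volume] G) (A : Set E) [Countable A] :
    ∀ᵐ x : E, ∑' t : A, F.indicator (fun _ => (1 : ℝ≥0∞)) (x + t) =
      ∑' t : A, G.indicator (fun _ => (1 : ℝ≥0∞)) (x + t) := by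
  have hshift : ∀ᵐ x : E, ∀ t : A, F.indicator (fun _ => (1 : ℝ≥0∞)) (x + t) =
      G.indicator (fun _ => (1 : ℝ≥0∞)) (x + t) := ae_all_iff.2 fun t =>
    (measurePreserving_add_right (volume : Measure E) (t : E)).quasiMeasurePreserving.ae
      (indicator_ae_eq_of_ae_eq_set hFG)
  exact hshift.mono fun x hx => tsum_congr hx

theorem tilesBy_of_bijOn_mkQ {L : Submodule ℤ E} [Countable L] {F G : Set E}
    (hG : Set.BijOn L.mkQ G Set.univ) (hFG : F =ᵐ[volume] G) : TilesBy F (L : Set E) := by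
  filter_upwards [ae_tsum_indicator_add_eq hFG (L : Set E)] with x hx
  obtain ⟨y, hy, hyx⟩ := hG.surjOn (Set.mem_univ (L.mkQ x))
  have hmem : y - x ∈ L := (Submodule.Quotient.eq L).1 hyx
  rw [hx, tsum_indicator_add_eq_one_of_injOn_mkQ hG.injOn (t := ⟨y - x, hmem⟩) (by simpa using hy)]

theorem packsBy_of_injOn_mkQ {M : Submodule ℤ E} [Countable M] {F G : Set E}
    (hG : Set.InjOn M.mkQ G) (hFG : F =ᵐ[volume] G) : PacksBy F (M : Set E) := by
  filter_upwards [ae_tsum_indicator_add_eq hFG (M : Set E)] with x hx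
  rw [hx]
  by_cases h : ∃ t : (M : Set E), x + t ∈ G
  · obtain ⟨t, ht⟩ := h
    exact (tsum_indicator_add_eq_one_of_injOn_mkQ hG ht).le
  · push Not at h
    simp [Set.indicator_of_notMem (h _)]

end Tilings

section ClosedSubgroups

variable {E : Type*} [NormedAddCommGroup E] [NormedSpace ℝ E]

/-- The largest linear subspace contained in an additive subgroup `H`: the union of all lines
through the origin that lie in `H`. -/
def lineSubspace (H : Submodule ℤ E) : Submodule ℝ E where
  carrier := {v | ∀ t : ℝ, t • v ∈ H}
  zero_mem' t := by simp
  add_mem' hv hw t := by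
    rw [smul_add]
    exact H.add_mem (hv t) (hw t)
  smul_mem' c v hv t := by
    rw [smul_smul]
    exact hv (t * c)

theorem mem_of_mem_lineSubspace {H : Submodule ℤ E} {v : E} (hv : v ∈ lineSubspace H) : v ∈ H := by
  simpa using hv 1

/-- The multiples `⌊t * c n⌋ • h n` of short vectors of `H` approximate `t • u`. -/
theorem mem_lineSubspace_of_tendsto {H : Submodule ℤ E} (hH : IsClosed (H : Set E)) {h : ℕ → E}
    (hmem : ∀ n, h n ∈ H) {c : ℕ → ℝ} {u : E} (hzero : Filter.Tendsto h Filter.atTop (𝓝 0))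
    (hlim : Filter.Tendsto (fun n => c n • h n) Filter.atTop (𝓝 u)) : u ∈ lineSubspace H := by
  intro t
  have hfract : Filter.Tendsto (fun n => Int.fract (t * c n) • h n) Filter.atTop (𝓝 0) := by
    refine squeeze_zero_norm (fun n => ?_) (tendsto_zero_iff_norm_tendsto_zero.1 hzero)
    rw [norm_smul, Real.norm_eq_abs, Int.abs_fract]
    exact mul_le_of_le_one_left (norm_nonneg _) (Int.fract_lt_one _).le
  have hfloor : Filter.Tendsto (fun n => ⌊t * c n⌋ • h n) Filter.atTop (𝓝 (t • u)) := by
    have hdiff := (hlim.const_smul t).sub hfract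
    rw [sub_zero] at hdiff
    refine hdiff.congr fun n => ?_
    rw [smul_smul, ← sub_smul, Int.self_sub_fract, Int.cast_smul_eq_zsmul]
  exact hH.mem_of_tendsto hfloor (Filter.Eventually.of_forall fun n => H.smul_mem _ (hmem n))

variable [FiniteDimensional ℝ E]

theorem exists_ne_zero_mem_lineSubspace_inf {H : Submodule ℤ E} (hH : IsClosed (H : Set E))
    (W : Submodule ℝ E) (hshort : ∀ ε > 0, ∃ h ∈ H, h ∈ W ∧ h ≠ 0 ∧ ‖h‖ < ε) :
    ∃ u ∈ lineSubspace H ⊓ W, u ≠ 0 := by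
  have : ProperSpace E := FiniteDimensional.proper ℝ E
  choose h hhH hhW hh0 hhε using fun n : ℕ => hshort (1 / ((n : ℝ) + 1)) (by positivity)
  obtain ⟨u, hu, φ, hφ, hlim⟩ := (isCompact_sphere (0 : E) 1).tendsto_subseq
    (x := fun n => ‖h n‖⁻¹ • h n) fun n => by simpa using norm_smul_inv_norm (𝕜 := ℝ) (hh0 n)
  have hzero : Filter.Tendsto (h ∘ φ) Filter.atTop (𝓝 0) :=
    (squeeze_zero_norm (fun n => (hhε n).le) tendsto_one_div_add_atTop_nhds_zero_nat).comp
      hφ.tendsto_atTop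
  refine ⟨u, ⟨mem_lineSubspace_of_tendsto hH (fun n => hhH (φ n)) hzero hlim, ?_⟩, ?_⟩
  · exact W.closed_of_finiteDimensional.mem_of_tendsto hlim
      (Filter.Eventually.of_forall fun n => W.smul_mem _ (hhW _))
  · rintro rfl
    simp at hu

theorem discreteTopology_comap_subtype {H : Submodule ℤ E} (hH : IsClosed (H : Set E))
    {W : Submodule ℝ E} (hW : Disjoint (lineSubspace H) W) :
    DiscreteTopology (H.comap (W.subtype.restrictScalars ℤ)) := by
  apply discreteTopology_of_isOpen_singleton_zero
  rw [Metric.isOpen_singleton_iff]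
  by_contra! hshort
  obtain ⟨u, hu, hu0⟩ := exists_ne_zero_mem_lineSubspace_inf hH W fun ε hε => by
    obtain ⟨y, hy, hy0⟩ := hshort ε hε
    refine ⟨y, y.2, y.1.2, fun h => hy0 (Subtype.ext (Subtype.ext h)), ?_⟩
    simpa [dist_zero_right] using hy
  exact hu0 ((Submodule.mem_bot ℝ).1 (hW.eq_bot ▸ hu))

end ClosedSubgroups

section MixedSpan

variable {E α β : Type*}

section Module

variable [AddCommGroup E] [Module ℝ E]

/-- The additive subgroup that is `ℝ^α × ℤ^β` in the coordinates of a basis indexed by `α ⊕ β`.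
Every closed subgroup that spans the space is of this form. -/
def mixedSpan (b : Module.Basis (α ⊕ β) ℝ E) : Submodule ℤ E where
  carrier := {x | ∀ j, b.repr x (Sum.inr j) ∈ Set.range (Int.cast : ℤ → ℝ)}
  zero_mem' j := ⟨0, by simp⟩
  add_mem' hx hy j := by
    obtain ⟨⟨p, hp⟩, ⟨q, hq⟩⟩ := And.intro (hx j) (hy j)
    exact ⟨p + q, by simp [hp, hq]⟩
  smul_mem' n x hx j := by
    obtain ⟨p, hp⟩ := hx j
    exact ⟨n * p, by simp [hp]⟩

end Module

/-- In the sum of the largest subspace `V` of `H` and a complement `W`, the subgroup `H` is the sum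
of `V` and the lattice `H ∩ W`. -/
theorem exists_basis_eq_mixedSpan [NormedAddCommGroup E] [NormedSpace ℝ E] [FiniteDimensional ℝ E]
    {H : Submodule ℤ E} (hH : IsClosed (H : Set E)) (hspan : Submodule.span ℝ (H : Set E) = ⊤) :
    ∃ (α β : Type) (_ : Fintype α) (_ : Fintype β) (b : Module.Basis (α ⊕ β) ℝ E),
      H = mixedSpan b := by
  obtain ⟨W, hW⟩ := (lineSubspace H).exists_isCompl
  let Λ : Submodule ℤ W := H.comap (W.subtype.restrictScalars ℤ)
  have : DiscreteTopology Λ := discreteTopology_comap_subtype hH hW.disjoint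
  let e := (lineSubspace H).prodEquivOfIsCompl W hW
  have hmem : ∀ x, x ∈ H ↔ (e.symm x).2 ∈ Λ := fun x => by
    obtain ⟨p, rfl⟩ := e.surjective x
    rw [e.symm_apply_apply]
    exact H.add_mem_iff_right (mem_of_mem_lineSubspace p.1.2)
  have : IsZLattice ℝ Λ := ⟨by
    let proj : E →ₗ[ℝ] W := (LinearMap.snd ℝ _ W).comp e.symm.toLinearMap
    have hproj : LinearMap.range proj = ⊤ :=
      LinearMap.range_eq_top.2 (Prod.snd_surjective.comp e.symm.surjective)
    rw [eq_top_iff, ← hproj, ← Submodule.map_top, ← hspan, Submodule.map_span]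
    exact Submodule.span_mono (Set.image_subset_iff.2 fun x hx => (hmem x).1 hx)⟩
  let bΛ := Module.finBasis ℤ Λ
  let bW := bΛ.ofZLatticeBasis ℝ
  have hΛ : ∀ w : W, w ∈ Λ ↔ ∀ j, bW.repr w j ∈ Set.range (Int.cast : ℤ → ℝ) := fun w =>
    (SetLike.ext_iff.1 (bΛ.ofZLatticeBasis_span ℝ) w).symm.trans (bW.mem_span_iff_repr_mem ℤ w)
  refine ⟨_, _, inferInstance, inferInstance,
    ((Module.finBasis ℝ (lineSubspace H)).prod bW).map e, Submodule.ext fun x => ?_⟩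
  rw [hmem, hΛ]
  exact forall_congr' fun j => by
    rw [Module.Basis.map_repr, LinearEquiv.trans_apply, Module.Basis.prod_repr_inr]

theorem exists_basis_closure_eq_mixedSpan [NormedAddCommGroup E] [NormedSpace ℝ E]
    [FiniteDimensional ℝ E] {G : Submodule ℤ E} (hspan : Submodule.span ℝ (G : Set E) = ⊤) :
    ∃ (α β : Type) (_ : Fintype α) (_ : Fintype β) (b : Module.Basis (α ⊕ β) ℝ E),
      closure (G : Set E) = mixedSpan b := by
  obtain ⟨α, β, hα, hβ, b, hb⟩ := exists_basis_eq_mixedSpan G.isClosed_topologicalClosure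
    (eq_top_mono (Submodule.span_mono G.le_topologicalClosure) hspan)
  exact ⟨α, β, hα, hβ, b, congrArg SetLike.coe hb⟩

end MixedSpan

section LatticeCells

variable {E ι : Type*} [NormedAddCommGroup E] [NormedSpace ℝ E] [Fintype ι]
  (c : Module.Basis ι ℝ E)

theorem floor_eq_iff_sub_mem_fundamentalDomain {x : E} {v : Submodule.span ℤ (Set.range c)} :
    ZSpan.floor c x = v ↔ x - v ∈ ZSpan.fundamentalDomain c := by
  have h := ZSpan.vadd_mem_fundamentalDomain c (-v) x
  rw [neg_inj, Submodule.vadd_def, vadd_eq_add, NegMemClass.coe_neg, neg_add_eq_sub] at h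
  rw [h, eq_comm]

theorem preimage_floor_singleton (v : Submodule.span ℤ (Set.range c)) :
    ZSpan.floor c ⁻¹' {v} = (fun x => x + -(v : E)) ⁻¹' ZSpan.fundamentalDomain c := by
  simp only [← sub_eq_add_neg]
  exact Set.ext fun x => floor_eq_iff_sub_mem_fundamentalDomain c

theorem finite_image_floor {A : Set E} (hA : Bornology.IsBounded A) :
    (ZSpan.floor c '' A).Finite := by
  have : FiniteDimensional ℝ E := c.finiteDimensional_of_finite
  have : ProperSpace E := FiniteDimensional.proper ℝ E
  refine Set.Finite.of_finite_image ((ZSpan.setFinite_inter c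
    (hA.sub (ZSpan.fundamentalDomain_isBounded c))).subset ?_) Subtype.val_injective.injOn
  rintro _ ⟨_, ⟨x, hx, rfl⟩, rfl⟩
  exact ⟨⟨x, hx, ZSpan.fract c x, ZSpan.fract_mem_fundamentalDomain c x, by simp [ZSpan.fract]⟩,
    Subtype.prop _⟩

theorem isBounded_image_add_floor {A : Set E} (hA : Bornology.IsBounded A)
    (l : Submodule.span ℤ (Set.range c) → E) :
    Bornology.IsBounded ((fun x => x + l (ZSpan.floor c x)) '' A) :=
  (hA.add ((finite_image_floor c hA).image l).isBounded).subset (Set.image_subset_iff.2 fun x hx =>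
    Set.add_mem_add hx ⟨_, ⟨x, hx, rfl⟩, rfl⟩)

variable [MeasurableSpace E] [BorelSpace E] (μ : Measure E) [μ.IsAddHaarMeasure]

theorem measure_preimage_floor (I : Set (Submodule.span ℤ (Set.range c))) :
    μ (ZSpan.floor c ⁻¹' I) = I.encard * μ (ZSpan.fundamentalDomain c) := by
  have : FiniteDimensional ℝ E := c.finiteDimensional_of_finite
  have hI : ZSpan.floor c ⁻¹' I = ⋃ v ∈ I, ZSpan.floor c ⁻¹' {v} := by
    rw [← Set.preimage_iUnion₂, Set.biUnion_of_singleton]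
  rw [hI, measure_biUnion I.to_countable]
  · simp only [preimage_floor_singleton, measure_preimage_add_right, ENNReal.tsum_const]
    rfl
  · exact fun v _ w _ hvw => (Set.disjoint_singleton.2 hvw).preimage _
  · exact fun v _ => preimage_floor_singleton c v ▸
      (measurable_add_const (-(v : E))) (ZSpan.fundamentalDomain_measurableSet c)

theorem measureReal_preimage_floor (I : Set (Submodule.span ℤ (Set.range c))) :
    μ.real (ZSpan.floor c ⁻¹' I) = I.ncard * μ.real (ZSpan.fundamentalDomain c) := by
  simp only [measureReal_def, measure_preimage_floor, ENNReal.toReal_mul]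
  congr 1
  rcases I.finite_or_infinite with hI | hI
  · simp [← hI.cast_ncard_eq]
  · simp [hI.encard_eq, hI.ncard]

end LatticeCells

section MixedFloor

variable {E α β : Type*} [Fintype α] [Fintype β]

section Module

variable [AddCommGroup E] [Module ℝ E] (b : Module.Basis (α ⊕ β) ℝ E)

/-- The projection to the span of the basis vectors indexed by `α`. -/
noncomputable def inlProj : E →ₗ[ℝ] E := ∑ i, (b.coord (Sum.inl i)).smulRight (b (Sum.inl i))

/-- Rounding down of the coordinates indexed by `β`. Its fibres are the translates by elements of
`mixedSpan b` of a parallelepiped, so a union of fibres behaves like a subset of `ℝ^α × ℤ^β`. -/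
noncomputable def mixedFloor (x : E) : E :=
  inlProj b x + ∑ j, ⌊b.repr x (Sum.inr j)⌋ • b (Sum.inr j)

omit [Fintype β] in
theorem inlProj_apply (x : E) :
    inlProj b x = ∑ i, b.repr x (Sum.inl i) • b (Sum.inl i) := by
  simp [inlProj]

theorem inlProj_add_sum_inr (x : E) :
    inlProj b x + ∑ j, b.repr x (Sum.inr j) • b (Sum.inr j) = x := by
  rw [inlProj_apply, ← Fintype.sum_sum_type fun k => b.repr x k • b k, b.sum_repr]

theorem sub_mixedFloor (x : E) :
    x - mixedFloor b x = ∑ j, Int.fract (b.repr x (Sum.inr j)) • b (Sum.inr j) := by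
  nth_rewrite 1 [← inlProj_add_sum_inr b x]
  simp only [mixedFloor, add_sub_add_left_eq_sub, ← Finset.sum_sub_distrib, Int.fract, sub_smul,
    Int.cast_smul_eq_zsmul]

theorem mixedFloor_add {h : E} (hh : h ∈ mixedSpan b) (x : E) :
    mixedFloor b (h + x) = h + mixedFloor b x := by
  rw [← sub_right_inj (a := h + x), sub_mixedFloor, add_sub_add_left_eq_sub, sub_mixedFloor]
  refine Finset.sum_congr rfl fun j _ => ?_
  obtain ⟨z, hz⟩ := hh j
  rw [map_add, Finsupp.add_apply, ← hz, Int.fract_intCast_add]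

theorem existsUnique_vadd_mem_preimage_mixedFloor {L : Submodule ℤ E} (hL : L ≤ mixedSpan b)
    {p : Set E} (hp : ∀ x, ∃! t : L, t +ᵥ x ∈ p) (x : E) :
    ∃! t : L, t +ᵥ x ∈ mixedFloor b ⁻¹' p := by
  have hshift (t : L) : t +ᵥ x ∈ mixedFloor b ⁻¹' p ↔ t +ᵥ mixedFloor b x ∈ p := by
    rw [Set.mem_preimage, Submodule.vadd_def, vadd_eq_add, mixedFloor_add b (hL t.2)]
    rfl
  simpa only [hshift] using hp (mixedFloor b x)

theorem mixedFloor_mem_mixedSpan (x : E) : mixedFloor b x ∈ mixedSpan b := by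
  classical
  intro j
  refine ⟨⌊b.repr x (Sum.inr j)⌋, ?_⟩
  simp [mixedFloor, inlProj_apply, Finsupp.single_apply, ← Int.cast_smul_eq_zsmul ℝ]

theorem mixedFloor_sub_mixedFloor (x : E) : mixedFloor b (x - mixedFloor b x) = 0 := by
  have h := mixedFloor_add b (mixedFloor_mem_mixedSpan b x) (x - mixedFloor b x)
  rwa [add_sub_cancel, left_eq_add] at h

theorem mixedFloor_eq_inlProj_add {x v : E} (hv : v ∈ mixedSpan b)
    (hx : ∀ j, b.repr (x - v) (Sum.inr j) ∈ Set.Ico (0 : ℝ) 1) :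
    mixedFloor b x = inlProj b x + (v - inlProj b v) := by
  have hzero : mixedFloor b (x - v) = inlProj b (x - v) := by
    simp only [mixedFloor, Int.floor_eq_zero_iff.2 (hx _), zero_smul, Finset.sum_const_zero,
      add_zero]
  rw [← add_sub_cancel v x, mixedFloor_add b hv, add_sub_cancel, hzero, map_sub]
  abel

end Module

variable [NormedAddCommGroup E] [NormedSpace ℝ E] (b : Module.Basis (α ⊕ β) ℝ E)

theorem norm_sub_mixedFloor_le (x : E) : ‖x - mixedFloor b x‖ ≤ ∑ j, ‖b (Sum.inr j)‖ := by
  rw [sub_mixedFloor]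
  refine norm_sum_le_of_le _ fun j _ => ?_
  rw [norm_smul, Real.norm_eq_abs, Int.abs_fract]
  exact mul_le_of_le_one_left (norm_nonneg _) (Int.fract_lt_one _).le

theorem isBounded_preimage_mixedFloor {S : Set E} (hS : Bornology.IsBounded S) :
    Bornology.IsBounded (mixedFloor b ⁻¹' S) :=
  hS.cthickening.subset fun x hx =>
    Metric.mem_cthickening_of_dist_le x _ _ S hx
      ((dist_eq_norm _ _).trans_le (norm_sub_mixedFloor_le b x))

end MixedFloor

section Grid

variable {E α β : Type*} [NormedAddCommGroup E] [NormedSpace ℝ E]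
  (b : Module.Basis (α ⊕ β) ℝ E) (n : ℕ)

/-- The basis `b` with the vectors indexed by `α` divided by `n + 1`. The translates of its
fundamental domain by the lattice it generates are the cells of a grid that is fine in the
directions of `α` and unrefined in those of `β`. -/
noncomputable def gridBasis : Module.Basis (α ⊕ β) ℝ E :=
  b.unitsSMul (Sum.elim (fun _ => (Units.mk0 ((n : ℝ) + 1) n.cast_add_one_ne_zero)⁻¹) 1)

/-- A bound for the diameter of the cells of `gridBasis b n` in the directions of `α`. -/
noncomputable def gridWidth [Fintype α] : ℝ := (∑ i, ‖b (Sum.inl i)‖) / ((n : ℝ) + 1)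

theorem tendsto_gridWidth [Fintype α] :
    Filter.Tendsto (fun n => gridWidth b n) Filter.atTop (𝓝 0) := by
  simpa [gridWidth, div_eq_mul_inv] using
    (tendsto_one_div_add_atTop_nhds_zero_nat (𝕜 := ℝ)).const_mul (∑ i, ‖b (Sum.inl i)‖)

theorem mem_fundamentalDomain_gridBasis {x : E} :
    x ∈ ZSpan.fundamentalDomain (gridBasis b n) ↔
      (∀ i, b.repr x (Sum.inl i) ∈ Set.Ico 0 (1 / ((n : ℝ) + 1))) ∧
        ∀ j, b.repr x (Sum.inr j) ∈ Set.Ico (0 : ℝ) 1 := by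
  have hn : (0 : ℝ) < n + 1 := n.cast_add_one_pos
  simp only [ZSpan.mem_fundamentalDomain, gridBasis, Module.Basis.repr_unitsSMul, Sum.forall,
    Sum.elim_inl, Sum.elim_inr, Pi.one_apply, inv_inv, inv_one, Units.smul_def,
    Units.val_one, Units.val_mk0, one_mul, smul_eq_mul, Set.mem_Ico, mul_nonneg_iff_of_pos_left hn,
    lt_div_iff₀' hn]

theorem span_gridBasis_le_mixedSpan :
    Submodule.span ℤ (Set.range (gridBasis b n)) ≤ mixedSpan b := by
  classical
  rw [Submodule.span_le, Set.range_subset_iff]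
  rintro (i | i) j
  · exact ⟨0, by simp [gridBasis, Module.Basis.unitsSMul_apply, Units.smul_def]⟩
  · exact ⟨if i = j then 1 else 0, by
      simp [gridBasis, Module.Basis.unitsSMul_apply, Finsupp.single_apply]⟩

variable [Fintype α] [Fintype β]

theorem mixedFloor_eq_of_floor_eq {x : E} {v : Submodule.span ℤ (Set.range (gridBasis b n))}
    (hx : ZSpan.floor (gridBasis b n) x = v) :
    mixedFloor b x = inlProj b x + (v - inlProj b v) :=
  mixedFloor_eq_inlProj_add b (span_gridBasis_le_mixedSpan b n v.2)
    ((mem_fundamentalDomain_gridBasis b n).1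
      ((floor_eq_iff_sub_mem_fundamentalDomain _).1 hx)).2

theorem norm_mixedFloor_sub_mixedFloor_le {x y : E}
    (hxy : ZSpan.floor (gridBasis b n) x = ZSpan.floor (gridBasis b n) y) :
    ‖mixedFloor b x - mixedFloor b y‖ ≤ gridWidth b n := by
  have hx := ((mem_fundamentalDomain_gridBasis b n).1
    ((floor_eq_iff_sub_mem_fundamentalDomain _).1 hxy)).1
  have hy := ((mem_fundamentalDomain_gridBasis b n).1
    ((floor_eq_iff_sub_mem_fundamentalDomain _).1 (rfl : ZSpan.floor (gridBasis b n) y = _))).1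
  rw [mixedFloor_eq_of_floor_eq b n hxy, mixedFloor_eq_of_floor_eq b n rfl,
    add_sub_add_right_eq_sub, ← map_sub, inlProj_apply, gridWidth, Finset.sum_div]
  refine norm_sum_le_of_le _ fun i _ => ?_
  rw [norm_smul, div_eq_mul_one_div, mul_comm]
  gcongr
  rw [← sub_sub_sub_cancel_right x y, map_sub, Finsupp.sub_apply]
  exact abs_sub_le_of_nonneg_of_le (hx i).1 (hx i).2.le (hy i).1 (hy i).2.le

theorem isHalfOpenPolyhedron_preimage_floor_inter {p : Set E} (hp : IsHalfOpenPolyhedron p)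
    (v : Submodule.span ℤ (Set.range (gridBasis b n))) :
    IsHalfOpenPolyhedron (ZSpan.floor (gridBasis b n) ⁻¹' {v} ∩ mixedFloor b ⁻¹' p) := by
  have hfloor : ZSpan.floor (gridBasis b n) ⁻¹' {v} ∩ mixedFloor b ⁻¹' p =
      ZSpan.floor (gridBasis b n) ⁻¹' {v} ∩ (fun x => inlProj b x + (v - inlProj b v)) ⁻¹' p :=
    Set.ext fun x => and_congr_right fun hx => by
      rw [Set.mem_preimage, mixedFloor_eq_of_floor_eq b n hx, Set.mem_preimage]
  rw [hfloor, preimage_floor_singleton]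
  exact ((isHalfOpenPolyhedron_fundamentalDomain _).preimage_add_right _).inter
    (hp.preimage_linear_add _ _)

theorem isPolyhedral_image_add {p : Set E} (hp : IsHalfOpenPolyhedron p)
    (hbd : Bornology.IsBounded p) (l : Submodule.span ℤ (Set.range (gridBasis b n)) → E) :
    IsPolyhedral ((fun x => x + l (ZSpan.floor (gridBasis b n) x)) '' (mixedFloor b ⁻¹' p)) := by
  have hpieces : (fun x => x + l (ZSpan.floor (gridBasis b n) x)) '' (mixedFloor b ⁻¹' p) =
      ⋃ v ∈ ZSpan.floor (gridBasis b n) '' (mixedFloor b ⁻¹' p),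
        (fun x => x + -l v) ⁻¹' (ZSpan.floor (gridBasis b n) ⁻¹' {v} ∩ mixedFloor b ⁻¹' p) := by
    refine subset_antisymm (Set.image_subset_iff.2 fun x hx => ?_)
      (Set.iUnion₂_subset fun v _ y hy => ?_)
    · exact Set.mem_biUnion (Set.mem_image_of_mem _ hx) (by simpa using hx)
    · refine ⟨y + -l v, hy.2, ?_⟩
      have hfloor : ZSpan.floor (gridBasis b n) (y + -l v) = v := hy.1
      simp only [hfloor, neg_add_cancel_right]
  rw [hpieces]
  exact isPolyhedral_biUnion
    (finite_image_floor _ (isBounded_preimage_mixedFloor b hbd)) fun v _ =>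
      (isHalfOpenPolyhedron_preimage_floor_inter b n hp v).preimage_add_right _

theorem isPolyhedral_preimage_mixedFloor {p : Set E} (hp : IsHalfOpenPolyhedron p)
    (hbd : Bornology.IsBounded p) : IsPolyhedral (mixedFloor b ⁻¹' p) := by
  simpa using isPolyhedral_image_add b 0 hp hbd 0

end Grid

section GridVolume

variable {E : Type*} [NormedAddCommGroup E] [NormedSpace ℝ E] [MeasurableSpace E] [BorelSpace E]
  (μ : Measure E) [μ.IsAddHaarMeasure]

theorem measureReal_fundamentalDomain_pos {ι : Type*} [Finite ι] (c : Module.Basis ι ℝ E) :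
    0 < μ.real (ZSpan.fundamentalDomain c) := by
  have := Fintype.ofFinite ι
  have : FiniteDimensional ℝ E := c.finiteDimensional_of_finite
  have : ProperSpace E := FiniteDimensional.proper ℝ E
  exact ENNReal.toReal_pos (ZSpan.measure_fundamentalDomain_ne_zero c)
    (ZSpan.fundamentalDomain_isBounded c).measure_lt_top.ne

variable {α β : Type*} [Finite α] [Finite β] (b : Module.Basis (α ⊕ β) ℝ E)

theorem measureReal_fundamentalDomain_gridBasis (n : ℕ) :
    μ.real (ZSpan.fundamentalDomain (gridBasis b n)) =
      μ.real (ZSpan.fundamentalDomain b) / ((n : ℝ) + 1) ^ Nat.card α := by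
  classical
  have := Fintype.ofFinite α
  have := Fintype.ofFinite β
  have hdet : b.det (gridBasis b n) = (((n : ℝ) + 1) ^ Nat.card α)⁻¹ := by
    simp [gridBasis, Module.Basis.det_unitsSMul_self, Fintype.prod_sum_type]
  rw [ZSpan.measureReal_fundamentalDomain (gridBasis b n) μ b, hdet,
    abs_of_pos (by positivity), div_eq_inv_mul]

theorem tendsto_measureReal_fundamentalDomain_gridBasis_div :
    Filter.Tendsto (fun n => μ.real (ZSpan.fundamentalDomain (gridBasis b n)) /
      μ.real (ZSpan.fundamentalDomain (gridBasis b (n + 1)))) Filter.atTop (𝓝 1) := by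
  have hV := (measureReal_fundamentalDomain_pos μ b).ne'
  have hlim : Filter.Tendsto (fun n : ℕ => (1 + 1 / ((n : ℝ) + 1)) ^ Nat.card α)
      Filter.atTop (𝓝 1) := by
    simpa using ((tendsto_one_div_add_atTop_nhds_zero_nat (𝕜 := ℝ)).const_add 1).pow
      (Nat.card α)
  refine hlim.congr fun n => ?_
  simp only [measureReal_fundamentalDomain_gridBasis]
  rw [one_add_div n.cast_add_one_ne_zero, div_pow]
  push_cast
  field_simp

end GridVolume

section Counting

variable {E α β : Type*} [NormedAddCommGroup E] [NormedSpace ℝ E] [Fintype α] [Fintype β]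
  (b : Module.Basis (α ⊕ β) ℝ E)

theorem mem_cthickening_frontier_preimage_mixedFloor {S : Set E} {x y : E} {δ : ℝ}
    (hx : mixedFloor b x ∈ S) (hy : mixedFloor b y ∉ S)
    (hxy : ‖mixedFloor b x - mixedFloor b y‖ ≤ δ) :
    x ∈ Metric.cthickening δ (frontier (mixedFloor b ⁻¹' S)) := by
  have : FiniteDimensional ℝ E := b.finiteDimensional_of_finite
  let z := mixedFloor b y + (x - mixedFloor b x)
  have hz : z ∈ (mixedFloor b ⁻¹' S)ᶜ := by
    rw [Set.mem_compl_iff, Set.mem_preimage,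
      mixedFloor_add b (mixedFloor_mem_mixedSpan b y), mixedFloor_sub_mixedFloor, add_zero]
    exact hy
  obtain ⟨w, hw, hxw⟩ := exists_mem_frontier_infDist_compl_eq_dist (s := mixedFloor b ⁻¹' S) hx
    ((Set.ne_univ_iff_exists_notMem _).2 ⟨z, hz⟩)
  refine Metric.mem_cthickening_of_dist_le x w δ _ hw ?_
  calc dist x w ≤ dist x z := hxw ▸ Metric.infDist_le_dist_of_mem hz
    _ = ‖mixedFloor b x - mixedFloor b y‖ := by rw [dist_eq_norm]; congr 1; simp only [z]; abel
    _ ≤ δ := hxy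

/-- The layer around the boundary of `mixedFloor b ⁻¹' S` that is swept by the cells of
`gridBasis b n` meeting both this set and its complement. -/
def gridLayer (n : ℕ) (S : Set E) : Set E :=
  Metric.cthickening (gridWidth b n) (frontier (mixedFloor b ⁻¹' S))

theorem gridLayer_compl (n : ℕ) (S : Set E) : gridLayer b n Sᶜ = gridLayer b n S := by
  rw [gridLayer, Set.preimage_compl, frontier_compl, gridLayer]

theorem preimage_floor_image_subset (n : ℕ) (S : Set E) :
    ZSpan.floor (gridBasis b n) ⁻¹' (ZSpan.floor (gridBasis b n) '' (mixedFloor b ⁻¹' S)) ⊆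
      mixedFloor b ⁻¹' S ∪ gridLayer b n S := by
  rintro x ⟨y, hy, hyx⟩
  refine or_iff_not_imp_left.2 fun hx => ?_
  rw [← gridLayer_compl]
  exact mem_cthickening_frontier_preimage_mixedFloor b hx (not_not.2 hy)
    (norm_mixedFloor_sub_mixedFloor_le b n hyx.symm)

theorem isBounded_gridLayer (n : ℕ) {S : Set E} (hS : Bornology.IsBounded S) :
    Bornology.IsBounded (gridLayer b n S) :=
  ((isBounded_preimage_mixedFloor b hS).closure.subset frontier_subset_closure).cthickening

variable [ProperSpace E] [MeasurableSpace E] [BorelSpace E] (μ : Measure E) [μ.IsAddHaarMeasure]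

theorem ncard_image_floor_mul_le (n : ℕ) {S : Set E} (hS : Bornology.IsBounded S) :
    (ZSpan.floor (gridBasis b n) '' (mixedFloor b ⁻¹' S)).ncard *
        μ.real (ZSpan.fundamentalDomain (gridBasis b n)) ≤
      μ.real (mixedFloor b ⁻¹' S) + μ.real (gridLayer b n S) := by
  rw [← measureReal_preimage_floor]
  exact (measureReal_mono (preimage_floor_image_subset b n S)
    ((isBounded_preimage_mixedFloor b hS).union
      (isBounded_gridLayer b n hS)).measure_lt_top.ne).trans (measureReal_union_le _ _)

theorem measureReal_preimage_mixedFloor_le (n : ℕ) {S : Set E} (hS : Bornology.IsBounded S) :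
    μ.real (mixedFloor b ⁻¹' S) ≤
      (ZSpan.floor (gridBasis b n) '' (mixedFloor b ⁻¹' Sᶜ))ᶜ.ncard *
        μ.real (ZSpan.fundamentalDomain (gridBasis b n)) + μ.real (gridLayer b n S) := by
  let I := (ZSpan.floor (gridBasis b n) '' (mixedFloor b ⁻¹' Sᶜ))ᶜ
  have hinner : ZSpan.floor (gridBasis b n) ⁻¹' I ⊆ mixedFloor b ⁻¹' S := fun x hx =>
    not_not.1 fun hxS => hx ⟨x, hxS, rfl⟩
  have hcover : mixedFloor b ⁻¹' S ⊆ ZSpan.floor (gridBasis b n) ⁻¹' I ∪ gridLayer b n S := by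
    intro x hx
    refine or_iff_not_imp_left.2 fun hxI => ?_
    rw [← gridLayer_compl]
    exact (preimage_floor_image_subset b n Sᶜ (not_not.1 hxI)).resolve_left (not_not.2 hx)
  rw [← measureReal_preimage_floor]
  exact (measureReal_mono hcover (((isBounded_preimage_mixedFloor b hS).subset hinner).union
    (isBounded_gridLayer b n hS)).measure_lt_top.ne).trans (measureReal_union_le _ _)

theorem tendsto_measureReal_gridLayer {S : Set E} (hS : Bornology.IsBounded S)
    (hnull : μ (frontier (mixedFloor b ⁻¹' S)) = 0) :
    Filter.Tendsto (fun n => μ.real (gridLayer b n S)) Filter.atTop (𝓝 0) := by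
  have hcompact : IsCompact (frontier (mixedFloor b ⁻¹' S)) :=
    Metric.isCompact_of_isClosed_isBounded isClosed_frontier
      ((isBounded_preimage_mixedFloor b hS).closure.subset frontier_subset_closure)
  have hlim := (tendsto_measure_cthickening_of_isCompact (μ := μ) hcompact).comp
    (tendsto_gridWidth b)
  rw [hnull] at hlim
  simpa [Function.comp_def, gridLayer, measureReal_def] using
    (ENNReal.tendsto_toReal ENNReal.zero_ne_top).comp hlim

theorem eventually_ncard_image_floor_le {S T : Set E} (hS : Bornology.IsBounded S)
    (hT : Bornology.IsBounded T) (hS0 : μ (frontier (mixedFloor b ⁻¹' S)) = 0)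
    (hT0 : μ (frontier (mixedFloor b ⁻¹' T)) = 0)
    (hST : μ.real (mixedFloor b ⁻¹' S) < μ.real (mixedFloor b ⁻¹' T)) :
    ∀ᶠ n in Filter.atTop,
      (ZSpan.floor (gridBasis b (n + 1)) '' (mixedFloor b ⁻¹' S)).ncard ≤
        (ZSpan.floor (gridBasis b n) '' (mixedFloor b ⁻¹' Tᶜ))ᶜ.ncard := by
  let V (n : ℕ) : ℝ := μ.real (ZSpan.fundamentalDomain (gridBasis b n))
  have hV (n : ℕ) : 0 < V n := measureReal_fundamentalDomain_pos μ _
  have hupper : Filter.Tendsto (fun n => (μ.real (mixedFloor b ⁻¹' S) +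
      μ.real (gridLayer b (n + 1) S)) * (V n / V (n + 1))) Filter.atTop
      (𝓝 (μ.real (mixedFloor b ⁻¹' S))) := by
    simpa using (((tendsto_measureReal_gridLayer b μ hS hS0).comp
      (Filter.tendsto_add_atTop_nat 1)).const_add (μ.real (mixedFloor b ⁻¹' S))).mul
      (tendsto_measureReal_fundamentalDomain_gridBasis_div μ b)
  have hlower : Filter.Tendsto (fun n => μ.real (mixedFloor b ⁻¹' T) -
      μ.real (gridLayer b n T)) Filter.atTop (𝓝 (μ.real (mixedFloor b ⁻¹' T))) := by
    simpa using (tendsto_measureReal_gridLayer b μ hT hT0).const_sub (μ.real (mixedFloor b ⁻¹' T))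
  filter_upwards [hupper.eventually_lt hlower hST] with n hn
  rw [← Nat.cast_le (α := ℝ), ← mul_le_mul_iff_left₀ (hV n)]
  calc _ = (ZSpan.floor (gridBasis b (n + 1)) '' (mixedFloor b ⁻¹' S)).ncard * V (n + 1) *
          (V n / V (n + 1)) := by field_simp [(hV (n + 1)).ne']
    _ ≤ (μ.real (mixedFloor b ⁻¹' S) + μ.real (gridLayer b (n + 1) S)) * (V n / V (n + 1)) := by
      gcongr
      exact ncard_image_floor_mul_le b μ (n + 1) hS
    _ ≤ μ.real (mixedFloor b ⁻¹' T) - μ.real (gridLayer b n T) := hn.le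
    _ ≤ _ := sub_le_iff_le_add.2 (measureReal_preimage_mixedFloor_le b μ n hT)

theorem exists_injOn_floor {S T : Set E} (hS : Bornology.IsBounded S)
    (hT : Bornology.IsBounded T) (hS0 : μ (frontier (mixedFloor b ⁻¹' S)) = 0)
    (hT0 : μ (frontier (mixedFloor b ⁻¹' T)) = 0)
    (hST : μ.real (mixedFloor b ⁻¹' S) < μ.real (mixedFloor b ⁻¹' T)) :
    ∃ (n : ℕ) (f : Submodule.span ℤ (Set.range (gridBasis b (n + 1))) →
        Submodule.span ℤ (Set.range (gridBasis b n))),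
      Set.InjOn f (ZSpan.floor (gridBasis b (n + 1)) '' (mixedFloor b ⁻¹' S)) ∧
        Set.MapsTo f (ZSpan.floor (gridBasis b (n + 1)) '' (mixedFloor b ⁻¹' S))
          (ZSpan.floor (gridBasis b n) '' (mixedFloor b ⁻¹' Tᶜ))ᶜ := by
  obtain ⟨n, hn⟩ := (eventually_ncard_image_floor_le b μ hS hT hS0 hT0 hST).exists
  have hfin := finite_image_floor (gridBasis b (n + 1)) (isBounded_preimage_mixedFloor b hS)
  have hle : (ZSpan.floor (gridBasis b (n + 1)) '' (mixedFloor b ⁻¹' S)).encard ≤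
      (ZSpan.floor (gridBasis b n) '' (mixedFloor b ⁻¹' Tᶜ))ᶜ.encard := by
    rw [← hfin.cast_ncard_eq]
    exact (Nat.cast_le.2 hn).trans (Set.ncard_le_encard _)
  obtain ⟨f, hf, hinj⟩ := hfin.exists_injOn_of_encard_le hle
  exact ⟨n, f, hinj, hf⟩

end Counting

section MovingCells

variable {E α β : Type*} [NormedAddCommGroup E] [NormedSpace ℝ E]
  (b : Module.Basis (α ⊕ β) ℝ E)

theorem exists_mem_forall_abs_repr_sub_lt {ι : Type*} [Finite ι] (c : Module.Basis ι ℝ E)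
    {s : Set E} {h : E} (hh : h ∈ closure s) {ε : ℝ} (hε : 0 < ε) :
    ∃ g ∈ s, ∀ k, |c.repr (g - h) k| < ε := by
  have : FiniteDimensional ℝ E := c.finiteDimensional_of_finite
  have hnear : ∀ᶠ g in 𝓝 h, ∀ k, |c.repr (g - h) k| < ε := Filter.eventually_all.2 fun k => by
    have hcont : Continuous fun g => |c.coord k (g - h)| :=
      ((c.coord k).continuous_of_finiteDimensional.comp (continuous_sub_right h)).abs
    exact (hcont.tendsto' h 0 (by simp)).eventually_lt_const hε
  obtain ⟨g, hg, hgh⟩ := ((mem_closure_iff_frequently.1 hh).and_eventually hnear).exists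
  exact ⟨g, hg, hgh⟩

theorem repr_inr_eq_zero_of_mem_mixedSpan {h : E} (hh : h ∈ mixedSpan b) {j : β}
    (hj : |b.repr h (Sum.inr j)| < 1) : b.repr h (Sum.inr j) = 0 := by
  obtain ⟨z, hz⟩ := hh j
  rw [← hz] at hj ⊢
  exact_mod_cast Int.abs_lt_one_iff.1 (by exact_mod_cast hj)

theorem add_mem_fundamentalDomain_gridBasis {m n : ℕ} {x u : E}
    (hx : x ∈ ZSpan.fundamentalDomain (gridBasis b n))
    (hinl : ∀ i, b.repr u (Sum.inl i) ∈ Set.Ico 0 (1 / ((m : ℝ) + 1) - 1 / ((n : ℝ) + 1)))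
    (hinr : ∀ j, b.repr u (Sum.inr j) = 0) :
    x + u ∈ ZSpan.fundamentalDomain (gridBasis b m) := by
  rw [mem_fundamentalDomain_gridBasis] at hx ⊢
  simp only [map_add, Finsupp.add_apply, hinr, add_zero]
  exact ⟨fun i => ⟨add_nonneg (hx.1 i).1 (hinl i).1,
    (add_lt_add (hx.1 i).2 (hinl i).2).trans_eq (add_sub_cancel _ _)⟩, hx.2⟩

/-- Cells of the coarser grid are larger, so an approximation in `G` of the vector that centres
the cell of `v` in that of `v'` still moves the first into the second. -/
theorem exists_mem_forall_floor_add_eq [Fintype α] [Fintype β] {G : Submodule ℤ E}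
    (hG : closure (G : Set E) = mixedSpan b) {m n : ℕ} (hmn : m < n)
    (v : Submodule.span ℤ (Set.range (gridBasis b n)))
    (v' : Submodule.span ℤ (Set.range (gridBasis b m))) :
    ∃ g ∈ G, ∀ x, ZSpan.floor (gridBasis b n) x = v → ZSpan.floor (gridBasis b m) (x + g) = v' := by
  classical
  let ε : ℝ := (1 / ((m : ℝ) + 1) - 1 / ((n : ℝ) + 1)) / 2
  have hε : 0 < ε := half_pos (sub_pos.2 (Nat.one_div_lt_one_div hmn))
  have hε1 : ε < 1 := by
    have hm : 1 / ((m : ℝ) + 1) ≤ 1 := div_le_one_of_le₀ (by simp) (by positivity)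
    have hn : 0 < 1 / ((n : ℝ) + 1) := Nat.one_div_pos_of_nat
    simp only [ε]
    linarith
  let s : E := ∑ i, ε • b (Sum.inl i)
  have hs_inl (i : α) : b.repr s (Sum.inl i) = ε := by simp [s, Finsupp.single_apply]
  have hs_inr (j : β) : b.repr s (Sum.inr j) = 0 := by simp [s]
  let h : E := v' - v + s
  have hh : h ∈ mixedSpan b := add_mem (sub_mem (span_gridBasis_le_mixedSpan b m v'.2)
    (span_gridBasis_le_mixedSpan b n v.2)) fun j => ⟨0, by rw [hs_inr, Int.cast_zero]⟩
  obtain ⟨g, hg, hgh⟩ :=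
    exists_mem_forall_abs_repr_sub_lt b (hG.symm ▸ hh : h ∈ closure (G : Set E)) hε
  have hgh_inr (j : β) : b.repr (g - h) (Sum.inr j) = 0 :=
    repr_inr_eq_zero_of_mem_mixedSpan b (sub_mem (hG.subset (subset_closure hg)) hh)
      ((hgh _).trans hε1)
  refine ⟨g, hg, fun x hx => ?_⟩
  have hdecomp : x + g - v' = x - v + (g - h + s) := by
    simp only [h]
    abel
  rw [floor_eq_iff_sub_mem_fundamentalDomain] at hx ⊢
  rw [hdecomp]
  refine add_mem_fundamentalDomain_gridBasis b hx (fun i => ?_) fun j => ?_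
  · obtain ⟨hlower, hupper⟩ := abs_lt.1 (hgh (Sum.inl i))
    have htwo : 1 / ((m : ℝ) + 1) - 1 / ((n : ℝ) + 1) = ε + ε := (add_halves _).symm
    rw [map_add, Finsupp.add_apply, hs_inl, htwo]
    exact ⟨by linarith, by linarith⟩
  · rw [map_add, Finsupp.add_apply, hs_inr, hgh_inr, add_zero]

end MovingCells

section FundamentalDomains

variable {E : Type*} [NormedAddCommGroup E] [NormedSpace ℝ E] [FiniteDimensional ℝ E]
  (L : Submodule ℤ E) [DiscreteTopology L]

theorem exists_isHalfOpenPolyhedron_existsUnique_vadd_mem [IsZLattice ℝ L] :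
    ∃ p : Set E, IsHalfOpenPolyhedron p ∧ Bornology.IsBounded p ∧ ∀ x, ∃! t : L, t +ᵥ x ∈ p := by
  let bL := Module.finBasis ℤ L
  let c := bL.ofZLatticeBasis ℝ
  refine ⟨ZSpan.fundamentalDomain c, isHalfOpenPolyhedron_fundamentalDomain c,
    ZSpan.fundamentalDomain_isBounded c, fun x => ?_⟩
  have h := ZSpan.exist_unique_vadd_mem_fundamentalDomain c x
  rwa [bL.ofZLatticeBasis_span ℝ] at h

variable [MeasurableSpace E] [BorelSpace E] (μ : Measure E) [μ.IsAddHaarMeasure]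

theorem IsPolyhedral.covolume_eq [IsZLattice ℝ L] {F : Set E} (hF : IsPolyhedral F)
    (hL : ∀ x, ∃! t : L, t +ᵥ x ∈ F) : ZLattice.covolume L μ = μ.real F :=
  ZLattice.covolume_eq_measure_fundamentalDomain L μ
    (.mk' (nullMeasurableSet_of_null_frontier (hF.addHaar_frontier μ)) hL)

end FundamentalDomains

section SimultaneousDomains

variable {E : Type*} [NormedAddCommGroup E] [NormedSpace ℝ E] [FiniteDimensional ℝ E]
  [MeasurableSpace E] [BorelSpace E] (μ : Measure E) [μ.IsAddHaarMeasure]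

theorem exists_translations_injOn {α β : Type*} [Fintype α] [Fintype β]
    (b : Module.Basis (α ⊕ β) ℝ E) {L M : Submodule ℤ E}
    (hb : closure ((L ⊔ M : Submodule ℤ E) : Set E) = mixedSpan b) {p q : Set E}
    (hp : IsHalfOpenPolyhedron p) (hq : IsHalfOpenPolyhedron q) (hpbd : Bornology.IsBounded p)
    (hqbd : Bornology.IsBounded q)
    (hpq : μ.real (mixedFloor b ⁻¹' p) < μ.real (mixedFloor b ⁻¹' q)) :
    ∃ (n : ℕ) (l m : Submodule.span ℤ (Set.range (gridBasis b n)) → E),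
      (∀ v, l v ∈ L) ∧ (∀ v, m v ∈ M) ∧
        Set.MapsTo (fun x => x + l (ZSpan.floor (gridBasis b n) x) +
          m (ZSpan.floor (gridBasis b n) x)) (mixedFloor b ⁻¹' p) (mixedFloor b ⁻¹' q) ∧
        Set.InjOn (fun x => x + l (ZSpan.floor (gridBasis b n) x) +
          m (ZSpan.floor (gridBasis b n) x)) (mixedFloor b ⁻¹' p) := by
  have : ProperSpace E := FiniteDimensional.proper ℝ E
  obtain ⟨n, f, hinj, hmaps⟩ := exists_injOn_floor b μ hpbd hqbd
    ((isPolyhedral_preimage_mixedFloor b hp hpbd).addHaar_frontier μ)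
    ((isPolyhedral_preimage_mixedFloor b hq hqbd).addHaar_frontier μ) hpq
  choose g hg hfloor using fun v => exists_mem_forall_floor_add_eq b hb n.lt_succ_self v (f v)
  choose l hl m hm hlm using fun v => Submodule.mem_sup.1 (hg v)
  refine ⟨n + 1, l, m, hl, hm, ?_⟩
  simp only [add_assoc, hlm]
  refine ⟨fun x hx => ?_, fun x hx y hy hxy => ?_⟩
  · by_contra hxq
    exact hmaps ⟨x, hx, rfl⟩ ⟨_, hxq, hfloor _ x rfl⟩
  · have hcell : ZSpan.floor (gridBasis b (n + 1)) x = ZSpan.floor (gridBasis b (n + 1)) y :=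
      hinj ⟨x, hx, rfl⟩ ⟨y, hy, rfl⟩ <| by
        rw [← hfloor _ x rfl, ← hfloor _ y rfl]
        exact congrArg _ hxy
    exact add_right_cancel (hxy.trans (by rw [hcell]))

theorem exists_isPolyhedral_bijOn_injOn (L M : Submodule ℤ E) [DiscreteTopology L] [IsZLattice ℝ L]
    [DiscreteTopology M] [IsZLattice ℝ M] (hvol : ZLattice.covolume L μ < ZLattice.covolume M μ) :
    ∃ F : Set E, IsPolyhedral F ∧ Bornology.IsBounded F ∧ Set.BijOn L.mkQ F Set.univ ∧
      Set.InjOn M.mkQ F := by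
  have hspan : Submodule.span ℝ ((L ⊔ M : Submodule ℤ E) : Set E) = ⊤ :=
    eq_top_mono (Submodule.span_mono (SetLike.coe_subset_coe.2 le_sup_left))
      (IsZLattice.span_top (K := ℝ) (L := L))
  obtain ⟨α, β, _, _, b, hb⟩ := exists_basis_closure_eq_mixedSpan hspan
  have hsup : L ⊔ M ≤ mixedSpan b := fun x hx => hb.subset (subset_closure hx)
  obtain ⟨p, hp, hpbd, hLp⟩ := exists_isHalfOpenPolyhedron_existsUnique_vadd_mem L
  obtain ⟨q, hq, hqbd, hMq⟩ := exists_isHalfOpenPolyhedron_existsUnique_vadd_mem M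
  have hLA := existsUnique_vadd_mem_preimage_mixedFloor b (le_sup_left.trans hsup) hLp
  have hMB := existsUnique_vadd_mem_preimage_mixedFloor b (le_sup_right.trans hsup) hMq
  rw [(isPolyhedral_preimage_mixedFloor b hp hpbd).covolume_eq L μ hLA,
    (isPolyhedral_preimage_mixedFloor b hq hqbd).covolume_eq M μ hMB] at hvol
  obtain ⟨n, l, m, hl, hm, hmaps, hinj⟩ := exists_translations_injOn μ b hb hp hq hpbd hqbd hvol
  exact ⟨_, isPolyhedral_image_add b n hp hpbd l,
    isBounded_image_add_floor _ (isBounded_preimage_mixedFloor b hpbd) l,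
    bijOn_injOn_mkQ_image_add (bijOn_mkQ_of_existsUnique_vadd_mem hLA)
      (bijOn_mkQ_of_existsUnique_vadd_mem hMB).injOn (fun _ _ => hl _) (fun _ _ => hm _) hmaps hinj⟩

end SimultaneousDomains

theorem theorem2_general {E : Type*} [NormedAddCommGroup E] [NormedSpace ℝ E]
    [FiniteDimensional ℝ E] [MeasureSpace E] [BorelSpace E] [(volume : Measure E).IsAddHaarMeasure]
    (L M : Submodule ℤ E) [DiscreteTopology L] [IsZLattice ℝ L] [DiscreteTopology M]
    [IsZLattice ℝ M] (hvol : ZLattice.covolume L < ZLattice.covolume M) :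
    ∃ F : Set E, Bornology.IsBounded F ∧ MeasurableSet F ∧ IsFiniteUnionOfPolytopes F ∧
      TilesBy F (L : Set E) ∧ PacksBy F (M : Set E) := by
  obtain ⟨F, hF, hbd, hL, hM⟩ := exists_isPolyhedral_bijOn_injOn volume L M hvol
  have hae : closure F =ᵐ[volume] F := closure_ae_eq_of_null_frontier (hF.addHaar_frontier volume)
  exact ⟨closure F, hbd.closure, isClosed_closure.measurableSet,
    hF.isFiniteUnionOfPolytopes_closure hbd, tilesBy_of_bijOn_mkQ hL hae,
    packsBy_of_injOn_mkQ hM hae⟩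

theorem theorem2 (d : ℕ) (L M : Submodule ℤ (EuclideanSpace ℝ (Fin d)))
    [DiscreteTopology L] [IsZLattice ℝ L] [DiscreteTopology M] [IsZLattice ℝ M]
    (hvol : ZLattice.covolume L < ZLattice.covolume M) :
    ∃ F : Set (EuclideanSpace ℝ (Fin d)),
      Bornology.IsBounded F ∧ MeasurableSet F ∧ IsFiniteUnionOfPolytopes F ∧
        TilesBy F (L : Set (EuclideanSpace ℝ (Fin d))) ∧
        PacksBy F (M : Set (EuclideanSpace ℝ (Fin d))) :=
  theorem2_general L M hvol
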